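/- Let $\mathrm{Mnd}_f(\mathrm{Set})$ be the category of finitary monads on $\mathrm{Set}$ (monads whose underlying endofunctor preserves filtered colimits) and all monad morphisms between them. An object $A$ of a category $\mathcal A$ is called finitely presentable if its hom-functor $\mathcal A(A,-)$ preserves filtered colimits, and finitely generated if $\mathcal A(A,-)$ preserves filtered colimits of monomorphisms, i.e. colimits of filtered diagrams $D\colon\mathcal D\to\mathcal A$ such that $Dh$ is a monomorphism for every morphism $h$ of $\mathcal D$. Corollary. In the category $\mathrm{Mnd}_f(\mathrm{Set})$ the classes of finitely presentable and finitely generated objects do not coincide: there exists a finitary monad on $\mathrm{Set}$ that is a finitely generated but not a finitely presentable object of $\mathrm{Mnd}_f(\mathrm{Set})$. -/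

import Mathlib

open CategoryTheory CategoryTheory.Limits Opposite

universe w v u

/-- An object `X` of a category `C` is finitely generated (relative to a universe `w` of small
sets) if its hom-functor `Hom(X, -)` preserves filtered colimits of monomorphisms, i.e. all
existing colimits of those small filtered diagrams `D : J ⥤ C` for which `D.map h` is a
monomorphism of `C` for every morphism `h` of `J`. It is the analogue of Mathlib's
`CategoryTheory.IsFinitelyPresentable.{w}`, where the condition on `D` is absent. -/
def IsFinitelyGeneratedObject {C : Type u} [Category.{v} C] (X : C) : Prop :=
  ∀ (J : Type w) [SmallCategory J] [IsFiltered J] (D : J ⥤ C),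
    (∀ ⦃i j : J⦄ (h : i ⟶ j), Mono (D.map h)) →
      PreservesColimit D (coyoneda.obj (op X))

/-- A monad on the category of sets (in the universe `u`) is finitary if its underlying
endofunctor preserves (small) filtered colimits. -/
def isFinitaryMonad : ObjectProperty (CategoryTheory.Monad (Type u)) :=
  fun T => PreservesFilteredColimits T.toFunctor

/-- The category of finitary monads on sets: the full subcategory, on the finitary monads, of
the category of all monads and monad morphisms. -/
abbrev FinitaryMonad : Type (u + 1) :=
  (isFinitaryMonad.{u}).FullSubcategory

/-! The question is transferred from monads to monoids. For a monoid `M`, monad morphisms `M × - ⟶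
S` are the homomorphisms from `M` to the monoid `S 1` of unary operations (`actionHomEquiv`). It
then suffices to find a finitely generated monoid that is a quotient by a union of congruences, none
of which is the whole union.

Finite generation: filtered colimits of finitary monads are computed pointwise, so `S ↦ S 1`
commutes with them, and monomorphisms are injective on unary operations. Images of finitely many
generators therefore lift to one stage, where the relations already hold by injectivity.

Failure of presentability: if `d` is the directed union of the `c i`, then `M/d` is the colimit of
the `M/c i`. Factoring its identity through some stage would force `d ≤ c k` for some `k`.

The example: words in `a, b`, collapsing all words with a factor `b aᵏ b`; bounding `k` by `n` gives
a chain that never stabilises. -/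

/-! ### Filtered colimits of finitary endofunctors and their self-composites. -/

section EndofunctorColimit

variable {J : Type u} [SmallCategory J] {G : J ⥤ Type u ⥤ Type u} {c : Cocone G}

/-- The legs of a cocone of endofunctors, as natural transformations into its vertex. -/
def CategoryTheory.Limits.Cocone.leg (c : Cocone G) (j : J) : G.obj j ⟶ c.pt := c.ι.app j

lemma CategoryTheory.Limits.Cocone.leg_w (c : Cocone G) {j k : J} (h : j ⟶ k) :
    G.map h ≫ c.leg k = c.leg j := c.w h

lemma CategoryTheory.Limits.Cocone.leg_app_map_app (c : Cocone G) {j k : J} (h : j ⟶ k)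
    {X : Type u} (x : (G.obj j).obj X) :
    (c.leg k).app X ((G.map h).app X x) = (c.leg j).app X x :=
  ConcreteCategory.congr_hom (NatTrans.congr_app (c.w h) X) x

lemma CategoryTheory.Limits.Cocone.map_leg_app_map (c : Cocone G) {j k : J} (h : j ⟶ k)
    {X : Type u} (F : Type u ⥤ Type u) (x : F.obj ((G.obj j).obj X)) :
    F.map ((c.leg k).app X) (F.map ((G.map h).app X) x) = F.map ((c.leg j).app X) x := by
  rw [← Functor.map_comp_apply, ← NatTrans.comp_app, c.leg_w]

lemma CategoryTheory.Limits.IsColimit.exists_leg_app_eq (hc : IsColimit c) {X : Type u}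
    (x : c.pt.obj X) : ∃ (j : J) (y : (G.obj j).obj X), (c.leg j).app X y = x :=
  Types.jointly_surjective_of_isColimit
    (isColimitOfPreserves ((evaluation (Type u) (Type u)).obj X) hc) x

variable [IsFiltered J]

lemma CategoryTheory.Limits.IsColimit.exists_leg_app_eq₂ (hc : IsColimit c) {X : Type u}
    (x y : c.pt.obj X) :
    ∃ (j : J) (x' y' : (G.obj j).obj X), (c.leg j).app X x' = x ∧ (c.leg j).app X y' = y :=
  Types.FilteredColimit.jointly_surjective_of_isColimit₂
    (isColimitOfPreserves ((evaluation (Type u) (Type u)).obj X) hc) x y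

lemma CategoryTheory.Limits.IsColimit.leg_app_eq_iff (hc : IsColimit c)
    {X : Type u} {j : J} (x y : (G.obj j).obj X) :
    (c.leg j).app X x = (c.leg j).app X y ↔
      ∃ (k : J) (h : j ⟶ k), (G.map h).app X x = (G.map h).app X y :=
  Types.FilteredColimit.isColimit_eq_iff'
    (isColimitOfPreserves ((evaluation (Type u) (Type u)).obj X) hc) x y

lemma CategoryTheory.Limits.IsColimit.exists_map_leg_app_eq (hc : IsColimit c) {X : Type u}
    (F : Type u ⥤ Type u) [PreservesFilteredColimits F] (x : F.obj (c.pt.obj X)) :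
    ∃ (j : J) (y : F.obj ((G.obj j).obj X)), F.map ((c.leg j).app X) y = x :=
  Types.jointly_surjective_of_isColimit (isColimitOfPreserves F
    (isColimitOfPreserves ((evaluation (Type u) (Type u)).obj X) hc)) x

lemma CategoryTheory.Limits.IsColimit.map_leg_app_eq_iff (hc : IsColimit c)
    {X : Type u} (F : Type u ⥤ Type u) [PreservesFilteredColimits F] {j : J}
    (x y : F.obj ((G.obj j).obj X)) :
    F.map ((c.leg j).app X) x = F.map ((c.leg j).app X) y ↔
      ∃ (k : J) (h : j ⟶ k), F.map ((G.map h).app X) x = F.map ((G.map h).app X) y :=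
  Types.FilteredColimit.isColimit_eq_iff' (isColimitOfPreserves F
    (isColimitOfPreserves ((evaluation (Type u) (Type u)).obj X) hc)) x y

/-- A filtered colimit of finitary endofunctors of sets is finitary. -/
lemma preservesFilteredColimits_of_isColimit (hc : IsColimit c)
    [hG : ∀ j, PreservesFilteredColimits (G.obj j)] : PreservesFilteredColimits c.pt := by
  refine ⟨fun K _ _ ↦ ⟨fun {F} ↦ ⟨fun {d} hd ↦ ⟨?_⟩⟩⟩⟩
  have hd' (j : J) : IsColimit ((G.obj j).mapCocone d) :=
    isColimitOfPreserves (G.obj j) hd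
  refine Types.FilteredColimit.isColimitOf' _ _ (fun z ↦ ?_) (fun k a b hab ↦ ?_)
  · obtain ⟨j, w, rfl⟩ := hc.exists_leg_app_eq z
    obtain ⟨k, v, rfl⟩ := Types.jointly_surjective_of_isColimit (hd' j) w
    exact ⟨k, (c.leg j).app _ v, NatTrans.naturality_apply (c.leg j) (d.ι.app k) v⟩
  -- The equality already holds at a stage `l`, and finitarity of `G.obj l` then realises it along
  -- the diagram `F`.
  · obtain ⟨j, a, b, rfl, rfl⟩ := hc.exists_leg_app_eq₂ a b
    dsimp at a b hab ⊢
    rw [← NatTrans.naturality_apply, ← NatTrans.naturality_apply, hc.leg_app_eq_iff] at hab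
    obtain ⟨l, h, hab⟩ := hab
    rw [NatTrans.naturality_apply, NatTrans.naturality_apply] at hab
    obtain ⟨k', h', hab⟩ := (Types.FilteredColimit.isColimit_eq_iff' (hd' l) _ _).1 hab
    refine ⟨k', h', ?_⟩
    dsimp at hab
    rw [← c.leg_app_map_app h, ← c.leg_app_map_app h, ← NatTrans.naturality_apply (c.leg l),
      ← NatTrans.naturality_apply (c.leg l)]
    exact congrArg _ hab

/-- The pointwise composite of a diagram of endofunctors with itself. -/
def CategoryTheory.Functor.compSelf (G : J ⥤ Type u ⥤ Type u) : J ⥤ Type u ⥤ Type u where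
  obj j := G.obj j ⋙ G.obj j
  map h := G.map h ◫ G.map h

/-- The composite with itself of a cocone of endofunctors. -/
def CategoryTheory.Limits.Cocone.compSelf (c : Cocone G) : Cocone G.compSelf where
  pt := c.pt ⋙ c.pt
  ι :=
    { app j := c.leg j ◫ c.leg j
      naturality j k h := by
        dsimp only [Functor.compSelf]
        rw [← NatTrans.exchange, c.leg_w]
        rfl }

lemma CategoryTheory.Limits.IsColimit.exists_hcomp_leg_app_eq (hc : IsColimit c)
    [hG : ∀ j, PreservesFilteredColimits (G.obj j)] {X : Type u} (z : c.pt.obj (c.pt.obj X)) :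
    ∃ (j : J) (x : (G.obj j).obj ((G.obj j).obj X)),
      (c.leg j).app _ ((G.obj j).map ((c.leg j).app X) x) = z := by
  obtain ⟨j, w, rfl⟩ := hc.exists_leg_app_eq z
  obtain ⟨k, v, rfl⟩ := hc.exists_map_leg_app_eq _ w
  refine ⟨IsFiltered.max j k, (G.map (IsFiltered.leftToMax j k)).app _
    ((G.obj j).map ((G.map (IsFiltered.rightToMax j k)).app X) v), ?_⟩
  rw [← NatTrans.naturality_apply (G.map (IsFiltered.leftToMax j k)), c.leg_app_map_app,
    c.map_leg_app_map]

/-- The outer leg is cancelled first, by moving to a stage `k`; then the inner one, using that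
`G.obj k` is finitary. -/
lemma CategoryTheory.Limits.IsColimit.hcomp_leg_app_eq (hc : IsColimit c)
    [hG : ∀ j, PreservesFilteredColimits (G.obj j)] {X : Type u} {j : J}
    {x y : (G.obj j).obj ((G.obj j).obj X)}
    (hxy : (c.leg j).app _ ((G.obj j).map ((c.leg j).app X) x) =
      (c.leg j).app _ ((G.obj j).map ((c.leg j).app X) y)) :
    ∃ (k : J) (h : j ⟶ k), (G.map h).app _ ((G.obj j).map ((G.map h).app X) x) =
      (G.map h).app _ ((G.obj j).map ((G.map h).app X) y) := by
  rw [hc.leg_app_eq_iff] at hxy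
  obtain ⟨k, h, hxy⟩ := hxy
  rw [← c.map_leg_app_map h, ← c.map_leg_app_map h, NatTrans.naturality_apply,
    NatTrans.naturality_apply, NatTrans.naturality_apply, NatTrans.naturality_apply,
    hc.map_leg_app_eq_iff] at hxy
  obtain ⟨l, h', hxy⟩ := hxy
  refine ⟨l, h ≫ h', ?_⟩
  have := congrArg ((G.map h').app _) hxy
  simpa [NatTrans.naturality_apply] using this

/-- Composition of finitary endofunctors commutes with filtered colimits along the diagonal. -/
noncomputable def isColimitCompSelf (hc : IsColimit c)
    [hG : ∀ j, PreservesFilteredColimits (G.obj j)] : IsColimit c.compSelf := by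
  refine evaluationJointlyReflectsColimits _ fun X ↦ ?_
  -- `◫` applies the outer transformation before mapping the inner one; naturality gives the
  -- opposite order used above.
  have key (j : J) (x : (G.obj j).obj ((G.obj j).obj X)) : (c.leg j ◫ c.leg j).app X x =
      (c.leg j).app _ ((G.obj j).map ((c.leg j).app X) x) := by
    rw [NatTrans.naturality_apply]; rfl
  have key' {j k : J} (h : j ⟶ k) (x : (G.obj j).obj ((G.obj j).obj X)) :
      (G.map h ◫ G.map h).app X x =
      (G.map h).app _ ((G.obj j).map ((G.map h).app X) x) := by
    rw [NatTrans.naturality_apply]; rfl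
  refine Types.FilteredColimit.isColimitOf' _ _ (fun z ↦ ?_) (fun j a b hab ↦ ?_)
  · obtain ⟨j, w, rfl⟩ := hc.exists_hcomp_leg_app_eq z
    exact ⟨j, w, (key j w).symm⟩
  · obtain ⟨k, h, e⟩ := hc.hcomp_leg_app_eq ((key j a).symm.trans (hab.trans (key j b)))
    exact ⟨k, h, (key' h a).trans (e.trans (key' h b).symm)⟩

end EndofunctorColimit

/-! ### Monad identities on elements. -/

section MonadApply

variable {S T : CategoryTheory.Monad (Type u)}

lemma CategoryTheory.MonadHom.app_η_apply (f : S ⟶ T) {X : Type u} (x : X) :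
    f.app X (S.η.app X x) = T.η.app X x :=
  ConcreteCategory.congr_hom (f.app_η X) x

lemma CategoryTheory.MonadHom.app_μ_apply (f : S ⟶ T) {X : Type u} (x : S.obj (S.obj X)) :
    f.app X (S.μ.app X x) = T.μ.app X (f.app _ (S.map (f.app X) x)) :=
  ConcreteCategory.congr_hom (f.app_μ X) x

lemma CategoryTheory.Monad.map_η_apply (T : CategoryTheory.Monad (Type u)) {X Y : Type u}
    (f : X ⟶ Y) (x : X) : T.map f (T.η.app X x) = T.η.app Y (f x) :=
  (ConcreteCategory.congr_hom (T.η.naturality f) x).symm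

lemma CategoryTheory.Monad.map_μ_apply (T : CategoryTheory.Monad (Type u)) {X Y : Type u}
    (f : X ⟶ Y) (x : T.obj (T.obj X)) :
    T.map f (T.μ.app X x) = T.μ.app Y (T.map (T.map f) x) :=
  (ConcreteCategory.congr_hom (T.μ.naturality f) x).symm

lemma CategoryTheory.Monad.μ_η_apply (T : CategoryTheory.Monad (Type u)) {X : Type u}
    (x : T.obj X) : T.μ.app X (T.η.app _ x) = x :=
  ConcreteCategory.congr_hom (T.left_unit X) x

lemma CategoryTheory.Monad.μ_map_η_apply (T : CategoryTheory.Monad (Type u)) {X : Type u}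
    (x : T.obj X) : T.μ.app X (T.map (T.η.app X) x) = x :=
  ConcreteCategory.congr_hom (T.right_unit X) x

lemma CategoryTheory.Monad.μ_μ_apply (T : CategoryTheory.Monad (Type u)) {X : Type u}
    (x : T.obj (T.obj (T.obj X))) :
    T.μ.app X (T.map (T.μ.app X) x) = T.μ.app X (T.μ.app _ x) :=
  ConcreteCategory.congr_hom (T.assoc X) x

end MonadApply

/-! ### Filtered colimits of finitary monads. -/

namespace FinitaryMonad

section Colimit

variable {J : Type u} [SmallCategory J] (D : J ⥤ FinitaryMonad.{u})

/-- The diagram of endofunctors underlying a diagram of finitary monads. -/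
abbrev endofunctors : J ⥤ Type u ⥤ Type u :=
  D ⋙ isFinitaryMonad.ι ⋙ monadToFunctor (Type u)

instance (T : FinitaryMonad.{u}) : PreservesFilteredColimits T.obj.toFunctor := T.property

instance (j : J) : PreservesFilteredColimits ((endofunctors D).obj j) := (D.obj j).property

/-- The endofunctor underlying the colimit of a filtered diagram of finitary monads. -/
noncomputable def colimitFunctor : Type u ⥤ Type u := colimit (endofunctors D)

/-- The legs of the colimit of endofunctors underlying a filtered colimit of finitary monads. -/
noncomputable def colimitLeg (j : J) : (D.obj j).obj.toFunctor ⟶ colimitFunctor D :=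
  (colimit.cocone (endofunctors D)).leg j

lemma colimitLeg_w {j k : J} (h : j ⟶ k) {X : Type u} (x : (D.obj j).obj.obj X) :
    (colimitLeg D k).app X ((D.map h).hom.app X x) = (colimitLeg D j).app X x :=
  (colimit.cocone (endofunctors D)).leg_app_map_app h x

lemma exists_colimitLeg_eq {X : Type u} (x : (colimitFunctor D).obj X) :
    ∃ (j : J) (y : (D.obj j).obj.obj X), (colimitLeg D j).app X y = x :=
  (colimit.isColimit (endofunctors D)).exists_leg_app_eq x

/-- The natural transformation induced by a cocone on a filtered diagram of finitary monads. -/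
noncomputable def colimitDesc (s : Cocone D) : colimitFunctor D ⟶ s.pt.obj.toFunctor :=
  colimit.desc (endofunctors D) ((isFinitaryMonad.ι ⋙ monadToFunctor (Type u)).mapCocone s)

lemma colimitDesc_colimitLeg (s : Cocone D) (j : J) {X : Type u} (x : (D.obj j).obj.obj X) :
    (colimitDesc D s).app X ((colimitLeg D j).app X x) = (s.ι.app j).hom.app X x :=
  ConcreteCategory.congr_hom (NatTrans.congr_app (colimit.ι_desc
    ((isFinitaryMonad.ι ⋙ monadToFunctor (Type u)).mapCocone s) j) X) x

variable [IsFiltered J]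

lemma colimitLeg_eq_iff {X : Type u} {j : J} (x y : (D.obj j).obj.obj X) :
    (colimitLeg D j).app X x = (colimitLeg D j).app X y ↔
      ∃ (k : J) (h : j ⟶ k), (D.map h).hom.app X x = (D.map h).hom.app X y :=
  (colimit.isColimit (endofunctors D)).leg_app_eq_iff x y

lemma exists_hcomp_colimitLeg_eq {X : Type u}
    (z : (colimitFunctor D).obj ((colimitFunctor D).obj X)) :
    ∃ (j : J) (x : (D.obj j).obj.obj ((D.obj j).obj.obj X)),
      (colimitLeg D j).app _ ((D.obj j).obj.map ((colimitLeg D j).app X) x) = z :=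
  (colimit.isColimit (endofunctors D)).exists_hcomp_leg_app_eq z

lemma exists_map_map_colimitLeg_eq {X : Type u} (F F' : Type u ⥤ Type u)
    [PreservesFilteredColimits F] [PreservesFilteredColimits F']
    (x : F.obj (F'.obj ((colimitFunctor D).obj X))) :
    ∃ (j : J) (y : F.obj (F'.obj ((D.obj j).obj.obj X))),
      F.map (F'.map ((colimitLeg D j).app X)) y = x :=
  (colimit.isColimit (endofunctors D)).exists_map_leg_app_eq (F' ⋙ F) x

/-- Reduces associativity of the colimit multiplication to that of a single stage: the outer two
layers are represented at `j`, the innermost at `k`, and both are moved to a common stage. -/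
lemma exists_hcomp₃_colimitLeg_eq {X : Type u}
    (z : (colimitFunctor D).obj ((colimitFunctor D).obj ((colimitFunctor D).obj X))) :
    ∃ (j : J) (x : (D.obj j).obj.obj ((D.obj j).obj.obj ((D.obj j).obj.obj X))),
      (colimitLeg D j).app _ ((D.obj j).obj.map ((colimitLeg D j).app _)
        ((D.obj j).obj.map ((D.obj j).obj.map ((colimitLeg D j).app X)) x)) = z := by
  obtain ⟨j, w, rfl⟩ := exists_hcomp_colimitLeg_eq D z
  obtain ⟨k, v, rfl⟩ := exists_map_map_colimitLeg_eq D (D.obj j).obj.toFunctor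
    (D.obj j).obj.toFunctor w
  let l := IsFiltered.max j k
  let h : j ⟶ l := IsFiltered.leftToMax j k
  let h' : k ⟶ l := IsFiltered.rightToMax j k
  refine ⟨l, (D.map h).hom.app _ ((D.obj j).obj.map ((D.map h).hom.app _)
    ((D.obj j).obj.map ((D.obj j).obj.map ((D.map h').hom.app X)) v)), ?_⟩
  rw [← NatTrans.naturality_apply (D.map h).hom.toNatTrans,
    ← NatTrans.naturality_apply (D.map h).hom.toNatTrans, colimitLeg_w]
  congr 1
  have e : (D.map h).hom.app _ ≫ (D.obj l).obj.map ((colimitLeg D l).app X) ≫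
      (colimitLeg D l).app _ =
      (D.obj j).obj.map ((colimitLeg D l).app X) ≫ (colimitLeg D j).app _ := by
    ext x
    change (colimitLeg D l).app _ ((D.obj l).obj.map _ ((D.map h).hom.app _ x)) =
      (colimitLeg D j).app _ ((D.obj j).obj.map _ x)
    rw [← NatTrans.naturality_apply (D.map h).hom.toNatTrans, colimitLeg_w]
  have e' : (D.map h').hom.app X ≫ (colimitLeg D l).app X = (colimitLeg D k).app X := by
    ext x
    exact colimitLeg_w D h' x
  rw [← Functor.map_comp_apply, ← Functor.map_comp_apply, e, Functor.map_comp_apply]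
  congr 1
  rw [← Functor.map_comp_apply, ← Functor.map_comp, e']

/-- The unit of the colimit of a filtered diagram of finitary monads. -/
noncomputable def colimitUnit : 𝟭 (Type u) ⟶ colimitFunctor D :=
  (D.obj (IsFiltered.nonempty (C := J)).some).obj.η ≫ colimitLeg D _

/-- The unit was defined at an arbitrary stage; any two stages map to a common one, and monad
morphisms preserve units. -/
lemma colimitLeg_unit (j : J) {X : Type u} (x : X) :
    (colimitLeg D j).app X ((D.obj j).obj.η.app X x) = (colimitUnit D).app X x := by
  have key {i k : J} (h : i ⟶ k) : (colimitLeg D k).app X ((D.obj k).obj.η.app X x) =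
      (colimitLeg D i).app X ((D.obj i).obj.η.app X x) := by
    rw [← colimitLeg_w D h, (D.map h).hom.app_η_apply]
  exact (key (IsFiltered.leftToMax j _)).symm.trans (key (IsFiltered.rightToMax j _))

/-- The cocone defining the multiplication of a filtered colimit of finitary monads. -/
noncomputable def multiplicationCocone : Cocone (endofunctors D).compSelf where
  pt := colimitFunctor D
  ι :=
    { app j := (D.obj j).obj.μ ≫ colimitLeg D j
      naturality j k h := by
        ext X x
        change (colimitLeg D k).app X ((D.obj k).obj.μ.app X ((D.obj k).obj.map
          ((D.map h).hom.app X) ((D.map h).hom.app _ x))) =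
          (colimitLeg D j).app X ((D.obj j).obj.μ.app X x)
        rw [← colimitLeg_w D h]
        refine congrArg ((colimitLeg D k).app X) (Eq.symm ?_)
        exact ((D.map h).hom.app_μ_apply x).trans (congrArg ((D.obj k).obj.μ.app X)
          (NatTrans.naturality_apply (D.map h).hom.toNatTrans ((D.map h).hom.app X) x)) }

/-- The multiplication of the colimit of a filtered diagram of finitary monads. -/
noncomputable def colimitMul : colimitFunctor D ⋙ colimitFunctor D ⟶ colimitFunctor D :=
  (isColimitCompSelf (colimit.isColimit (endofunctors D))).desc (multiplicationCocone D)

lemma colimitMul_hcomp_colimitLeg {j : J} {X : Type u}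
    (x : (D.obj j).obj.obj ((D.obj j).obj.obj X)) :
    (colimitMul D).app X ((colimitLeg D j).app _ ((D.obj j).obj.map ((colimitLeg D j).app X) x)) =
      (colimitLeg D j).app X ((D.obj j).obj.μ.app X x) := by
  have := ConcreteCategory.congr_hom (NatTrans.congr_app ((isColimitCompSelf
    (colimit.isColimit (endofunctors D))).fac (multiplicationCocone D) j) X) x
  refine Eq.trans ?_ this
  rw [NatTrans.naturality_apply]
  rfl

lemma map_colimitLeg_comp_colimitMul (j : J) (X : Type u) :
    (D.obj j).obj.map ((colimitLeg D j).app X) ≫ (colimitLeg D j).app _ ≫ (colimitMul D).app X =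
      (D.obj j).obj.μ.app X ≫ (colimitLeg D j).app X := by
  ext x
  exact colimitMul_hcomp_colimitLeg D x

/-- The colimit of a filtered diagram of finitary monads, as a monad. -/
noncomputable def colimitMonad : CategoryTheory.Monad (Type u) where
  toFunctor := colimitFunctor D
  η := colimitUnit D
  μ := colimitMul D
  assoc X := by
    ext z
    obtain ⟨j, w, rfl⟩ := exists_hcomp₃_colimitLeg_eq D z
    change (colimitMul D).app X ((colimitFunctor D).map ((colimitMul D).app X) _) =
      (colimitMul D).app X ((colimitMul D).app _ _)
    rw [colimitMul_hcomp_colimitLeg, ← Monad.map_μ_apply, colimitMul_hcomp_colimitLeg,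
      ← Monad.μ_μ_apply, ← colimitMul_hcomp_colimitLeg, ← NatTrans.naturality_apply]
    simp only [← Functor.map_comp_apply, ← map_colimitLeg_comp_colimitMul, Category.assoc]
  left_unit X := by
    ext z
    obtain ⟨j, w, rfl⟩ := exists_colimitLeg_eq D z
    change (colimitMul D).app X ((colimitUnit D).app _ _) = _
    rw [← colimitLeg_unit D j, ← Monad.map_η_apply, colimitMul_hcomp_colimitLeg,
      Monad.μ_η_apply]
    rfl
  right_unit X := by
    ext z
    obtain ⟨j, w, rfl⟩ := exists_colimitLeg_eq D z
    have e : (colimitUnit D).app X = (D.obj j).obj.η.app X ≫ (colimitLeg D j).app X := by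
      ext x
      exact (colimitLeg_unit D j x).symm
    change (colimitMul D).app X ((colimitFunctor D).map ((colimitUnit D).app X)
      ((colimitLeg D j).app X w)) = (colimitLeg D j).app X w
    refine (congrArg _ (NatTrans.naturality_apply (colimitLeg D j) ((colimitUnit D).app X) w).symm
      ).trans ?_
    rw [e, Functor.map_comp_apply, colimitMul_hcomp_colimitLeg,
      Monad.μ_map_η_apply]

/-- The colimit of a filtered diagram of finitary monads. -/
noncomputable def filteredColimit : FinitaryMonad.{u} where
  obj := colimitMonad D
  property := preservesFilteredColimits_of_isColimit (colimit.isColimit (endofunctors D))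

/-- The colimit cocone on a filtered diagram of finitary monads. -/
noncomputable def filteredColimitCocone : Cocone D where
  pt := filteredColimit D
  ι :=
    { app j := ObjectProperty.homMk
        { toNatTrans := colimitLeg D j
          app_η X := by
            ext x
            exact colimitLeg_unit D j x
          app_μ X := by
            ext x
            exact (colimitMul_hcomp_colimitLeg D x).symm }
      naturality j k h := by
        ext X x
        exact colimitLeg_w D h x }

/-- The pointwise colimit of a filtered diagram of finitary monads is a colimit. -/
noncomputable def isColimitFilteredColimitCocone : IsColimit (filteredColimitCocone D) where
  desc s := ObjectProperty.homMk
    { toNatTrans := colimitDesc D s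
      app_η X := by
        ext x
        let j : J := IsFiltered.nonempty.some
        change (colimitDesc D s).app X ((colimitUnit D).app X x) = s.pt.obj.η.app X x
        rw [← colimitLeg_unit D j, colimitDesc_colimitLeg]
        exact (s.ι.app j).hom.app_η_apply x
      app_μ X := by
        ext z
        obtain ⟨j, x, rfl⟩ := exists_hcomp_colimitLeg_eq D z
        change (colimitDesc D s).app X ((colimitMul D).app X _) = s.pt.obj.μ.app X
          ((colimitDesc D s).app _ ((colimitFunctor D).map ((colimitDesc D s).app X) _))
        rw [colimitMul_hcomp_colimitLeg, colimitDesc_colimitLeg]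
        refine ((s.ι.app j).hom.app_μ_apply x).trans (congrArg _ ?_)
        rw [← NatTrans.naturality_apply, colimitDesc_colimitLeg, ← Functor.map_comp_apply]
        have e : (colimitLeg D j).app X ≫ (colimitDesc D s).app X = (s.ι.app j).hom.app X := by
          ext x
          exact colimitDesc_colimitLeg D s j x
        rw [e]
        rfl }
  fac s j := by
    ext X x
    exact colimitDesc_colimitLeg D s j x
  uniq s m hm := by
    ext X z
    obtain ⟨j, x, rfl⟩ := exists_colimitLeg_eq D z
    refine Eq.trans ?_ (colimitDesc_colimitLeg D s j x).symm
    rw [← hm j]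
    rfl

end Colimit

end FinitaryMonad

/-! ### The monoid of unary operations of a monad. -/

/-- Substitution of an element `x` into an element of a functor at a point. -/
def CategoryTheory.Functor.substPoint (F : Type u ⥤ Type u) (s : F.obj PUnit.{u + 1})
    {X : Type u} (x : X) : F.obj X :=
  F.map (↾fun _ ↦ x) s

section Substitution

variable {F G : Type u ⥤ Type u}

lemma CategoryTheory.Functor.substPoint_unit (s : F.obj PUnit.{u + 1}) :
    F.substPoint s PUnit.unit = s :=
  F.map_id_apply _ s

lemma CategoryTheory.Functor.map_substPoint (s : F.obj PUnit.{u + 1}) {X Y : Type u} (f : X ⟶ Y)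
    (x : X) : F.map f (F.substPoint s x) = F.substPoint s (f x) := by
  unfold Functor.substPoint
  rw [← Functor.map_comp_apply]
  rfl

lemma CategoryTheory.NatTrans.app_substPoint (α : F ⟶ G) (s : F.obj PUnit.{u + 1}) {X : Type u}
    (x : X) : α.app X (F.substPoint s x) = G.substPoint (α.app _ s) x :=
  NatTrans.naturality_apply α _ _

lemma CategoryTheory.Monad.η_substPoint (T : CategoryTheory.Monad (Type u)) {X : Type u} (x : X) :
    T.substPoint (T.η.app _ PUnit.unit) x = T.η.app X x :=
  T.map_η_apply _ _

lemma CategoryTheory.Monad.μ_substPoint (T : CategoryTheory.Monad (Type u))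
    (s t : T.obj PUnit.{u + 1}) {X : Type u} (x : X) :
    T.substPoint (T.μ.app _ (T.substPoint s t)) x =
      T.μ.app X (T.substPoint s (T.substPoint t x)) := by
  rw [Functor.substPoint, Monad.map_μ_apply, Functor.map_substPoint]
  rfl

end Substitution

/-- The unary operations of a monad on sets, i.e. the elements of its value at a point. -/
def CategoryTheory.Monad.Unary (T : CategoryTheory.Monad (Type u)) : Type u := T.obj PUnit.{u + 1}

namespace CategoryTheory.Monad.Unary

variable {S T : CategoryTheory.Monad (Type u)}

/-- Evaluation of a unary operation at an element, given by substituting that element. -/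
def eval (s : S.Unary) {X : Type u} (x : X) : S.obj X := S.substPoint s x

/-- Unary operations form a monoid under substitution. -/
instance : Monoid T.Unary where
  one := T.η.app _ PUnit.unit
  mul s t := T.μ.app _ (T.substPoint s (X := T.obj PUnit) t)
  one_mul t := (congrArg _ (T.η_substPoint (X := T.obj PUnit) t)).trans (T.μ_η_apply _)
  mul_one t := T.μ_map_η_apply t
  mul_assoc r s t := by
    change T.μ.app _ (T.substPoint (T.μ.app _ (T.substPoint r s)) t) =
      T.μ.app _ (T.substPoint r (T.μ.app _ (T.substPoint s t)))
    exact (congrArg _ (T.μ_substPoint r s (X := T.obj PUnit) t)).trans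
      ((T.μ_μ_apply _).symm.trans (congrArg _ (Functor.map_substPoint ..)))

lemma eval_unit (s : S.Unary) : s.eval PUnit.unit = s :=
  Functor.substPoint_unit (F := S.toFunctor) s

lemma map_eval (s : S.Unary) {X Y : Type u} (f : X ⟶ Y) (x : X) :
    S.map f (s.eval x) = s.eval (f x) :=
  Functor.map_substPoint ..

lemma one_eval {X : Type u} (x : X) : (1 : S.Unary).eval x = S.η.app X x := S.η_substPoint _

lemma mul_eval (s t : S.Unary) {X : Type u} (x : X) :
    (s * t).eval x = S.μ.app X (s.eval (t.eval x)) :=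
  S.μ_substPoint _ _ _

/-- A monad morphism induces a homomorphism between the monoids of unary operations. -/
def map (f : S ⟶ T) : S.Unary →* T.Unary where
  toFun s := f.app PUnit s
  map_one' := f.app_η_apply _
  map_mul' _ _ := (f.app_μ_apply _).trans (congrArg _
    ((congrArg _ (Functor.map_substPoint ..)).trans (f.toNatTrans.app_substPoint _ _)))

lemma eval_map (f : S ⟶ T) (s : S.Unary) {X : Type u} (x : X) :
    (map f s).eval x = f.app X (s.eval x) :=
  (f.toNatTrans.app_substPoint s x).symm

end CategoryTheory.Monad.Unary

/-! ### Action monads and their universal property. -/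

namespace FinitaryMonad

open CategoryTheory.Monad

/-- The monad `M × -` of sets with an action of a monoid `M`. -/
def actionMonad (M : Type u) [Monoid M] : CategoryTheory.Monad (Type u) where
  obj X := M × X
  map f := ↾fun p ↦ (p.1, f p.2)
  η := { app X := ↾fun x ↦ (1, x) }
  μ := { app X := ↾fun p ↦ (p.1 * p.2.1, p.2.2) }
  assoc X := by
    ext p
    · exact (mul_assoc _ _ _).symm
    · rfl
  left_unit X := by
    ext p
    · exact one_mul _
    · rfl
  right_unit X := by
    ext p
    · exact mul_one _
    · rfl

/-- The finitary monad `M × -` of sets with an action of a monoid `M`. -/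
def action (M : Type u) [Monoid M] : FinitaryMonad.{u} where
  obj := actionMonad M
  property := by
    -- Finitarity is that of the product functor with `M`.
    have : (actionMonad M).toFunctor = MonoidalCategory.tensorLeft (C := Type u) M := rfl
    change PreservesFilteredColimits (actionMonad M).toFunctor
    rw [this]
    infer_instance

variable {M : Type u} [Monoid M] {S T : FinitaryMonad.{u}}

/-- The unary operation of acting by a given element. -/
def actionUnary (m : M) : (action M).obj.Unary := (m, PUnit.unit)

/-- Monad morphisms out of `M × -` are homomorphisms from `M` to the monoid of unary operations. -/
def actionHomEquiv : (action M ⟶ S) ≃ (M →* S.obj.Unary) where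
  toFun f := (Unary.map f.hom).comp
    { toFun := actionUnary
      map_one' := rfl
      map_mul' _ _ := rfl }
  invFun φ := ObjectProperty.homMk
    { app X := ↾fun p ↦ (φ p.1).eval p.2
      naturality X Y f := by
        ext p
        exact ((φ p.1).map_eval f p.2).symm
      app_η X := by
        ext x
        change (φ 1).eval x = _
        exact congrArg (·.eval x) φ.map_one |>.trans (Unary.one_eval x)
      app_μ X := by
        ext p
        change (φ (p.1 * p.2.1)).eval p.2.2 = S.obj.μ.app X ((φ p.1).eval ((φ p.2.1).eval p.2.2))
        rw [map_mul, Unary.mul_eval] }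
  left_inv f := by
    ext X p
    exact Unary.eval_map f.hom _ _
  right_inv φ := by
    ext m
    exact (φ m).eval_unit

lemma actionHomEquiv_comp (f : action M ⟶ S) (g : S ⟶ T) :
    actionHomEquiv (f ≫ g) = (Unary.map g.hom).comp (actionHomEquiv f) := rfl

/-- Unary operations are represented by the action monad of the free monoid on one generator. -/
lemma injective_unaryMap_of_mono (f : S ⟶ T) [Mono f] : Function.Injective (Unary.map f.hom) := by
  intro s t h
  let φ (s : S.obj.Unary) : action (FreeMonoid PUnit.{u + 1}) ⟶ S :=
    actionHomEquiv.symm (FreeMonoid.lift fun _ ↦ s)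
  have : φ s = φ t := by
    rw [← cancel_mono f]
    apply actionHomEquiv.injective
    apply FreeMonoid.hom_eq
    intro x
    simp [φ, actionHomEquiv_comp, h]
  simpa [φ] using DFunLike.congr_fun (actionHomEquiv.symm.injective this) (FreeMonoid.of PUnit.unit)


/-- Homomorphisms of monoids induce morphisms between the monads of monoid actions. -/
def actionMap {M N : Type u} [Monoid M] [Monoid N] (φ : M →* N) : action M ⟶ action N :=
  ObjectProperty.homMk
    { app X := ↾fun p ↦ (φ p.1, p.2)
      app_η X := by
        ext x
        exact Prod.ext_iff.2 ⟨φ.map_one, rfl⟩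
      app_μ X := by
        ext p
        exact Prod.ext_iff.2 ⟨φ.map_mul _ _, rfl⟩ }

lemma actionHomEquiv_actionMap_comp {M N : Type u} [Monoid M] [Monoid N] (φ : M →* N)
    {S : FinitaryMonad.{u}} (f : action N ⟶ S) :
    actionHomEquiv (actionMap φ ≫ f) = (actionHomEquiv f).comp φ := rfl

/-- The monoid of unary operations of `M × -` is `M`. -/
def unaryEquiv {M : Type u} [Monoid M] : (action M).obj.Unary ≃* M where
  toFun s := Prod.fst s
  invFun m := actionUnary m
  left_inv _ := rfl
  right_inv _ := rfl
  map_mul' _ _ := rfl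

/-! ### Finite generation of action monads. -/

section Generated

variable {J : Type u} [SmallCategory J] [IsFiltered J] {D : J ⥤ FinitaryMonad.{u}}

/-- Operations identified in the colimit are identified at a later stage, and transition maps are
injective on them. -/
lemma injective_unaryMap_filteredColimitCocone
    (hD : ∀ ⦃i j : J⦄ (h : i ⟶ j), Mono (D.map h)) (j : J) :
    Function.Injective (Unary.map ((filteredColimitCocone D).ι.app j).hom) := by
  intro x y hxy
  obtain ⟨k, h, e⟩ := (colimitLeg_eq_iff D _ _).1 hxy
  have := hD h
  exact injective_unaryMap_of_mono (D.map h) e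

lemma exists_unaryMap_filteredColimitCocone {α : Type*} [Finite α]
    (x : α → (filteredColimitCocone D).pt.obj.Unary) :
    ∃ (j : J) (y : α → (D.obj j).obj.Unary),
      ∀ a, Unary.map ((filteredColimitCocone D).ι.app j).hom (y a) = x a := by
  choose i y hy using fun a ↦ exists_colimitLeg_eq D (X := PUnit) (x a)
  classical
  have := Fintype.ofFinite α
  obtain ⟨j, hj⟩ := IsFiltered.sup_objs_exists (Finset.univ.image i)
  refine ⟨j, fun a ↦ (D.map (hj (X := i a) (by simp)).some).hom.app _ (y a), fun a ↦ ?_⟩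
  exact (colimitLeg_w D _ _).trans (hy a)

end Generated

/-- For a quotient `M` of a finitely generated free monoid, the monad `M × -` is finitely
generated. -/
theorem isFinitelyGeneratedObject_action {α : Type u} [Finite α] (d : Con (FreeMonoid α)) :
    IsFinitelyGeneratedObject.{u} (action d.Quotient) := by
  intro J _ _ D hD
  refine preservesColimit_of_preserves_colimit_cocone (isColimitFilteredColimitCocone D)
    (Types.FilteredColimit.isColimitOf' _ _ (fun f ↦ ?_) fun j f g hfg ↦ ⟨j, 𝟙 j, ?_⟩)
  · obtain ⟨j, y, hy⟩ := exists_unaryMap_filteredColimitCocone (D := D)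
      fun a : α ↦ actionHomEquiv f (d.mk' (FreeMonoid.of a))
    let ψ : FreeMonoid α →* (D.obj j).obj.Unary := FreeMonoid.lift y
    have hψ : (Unary.map ((filteredColimitCocone D).ι.app j).hom).comp ψ =
        (actionHomEquiv f).comp d.mk' :=
      FreeMonoid.hom_eq fun a ↦ by simpa [ψ] using hy a
    -- The relations of `d` hold in the colimit, hence at stage `j`; no finiteness of the set of
    -- relations is needed.
    have hd : d ≤ Con.ker ψ := fun x y hxy ↦ by
      apply injective_unaryMap_filteredColimitCocone hD j
      have := DFunLike.congr_fun hψ x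
      have h' := DFunLike.congr_fun hψ y
      simp only [MonoidHom.comp_apply] at this h'
      rw [this, h']
      exact congrArg _ (d.eq.2 hxy)
    refine ⟨j, actionHomEquiv.symm (d.lift ψ hd), actionHomEquiv.injective ?_⟩
    change actionHomEquiv f = actionHomEquiv (_ ≫ (filteredColimitCocone D).ι.app j)
    rw [actionHomEquiv_comp, Equiv.apply_symm_apply]
    exact Con.hom_ext hψ.symm
  · have e := congrArg actionHomEquiv
      (show f ≫ (filteredColimitCocone D).ι.app j = g ≫ (filteredColimitCocone D).ι.app j from hfg)
    rw [actionHomEquiv_comp, actionHomEquiv_comp] at e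
    have : f = g := actionHomEquiv.injective (MonoidHom.ext fun m ↦
      injective_unaryMap_filteredColimitCocone hD j (DFunLike.congr_fun e m))
    rw [this]

/-! ### Directed unions of congruences and non-presentability. -/

section Chain

variable {I : Type u} [Preorder I] {M : Type u} [Monoid M]

/-- The diagram of action monads of the quotients of a monoid by an increasing family of
congruences. -/
def quotientDiagram (c : I →o Con M) : I ⥤ FinitaryMonad.{u} where
  obj i := action (c i).Quotient
  map h := actionMap (Con.map _ _ (c.monotone h.le))
  map_id i := by
    ext X ⟨⟨x⟩, y⟩
    rfl
  map_comp f g := by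
    ext X ⟨⟨x⟩, y⟩
    rfl

variable {c : I →o Con M} {d : Con M}

/-- The cocone on `quotientDiagram c` given by the union of the congruences. -/
def quotientCocone (hd : ∀ x y, d x y ↔ ∃ i, c i x y) : Cocone (quotientDiagram c) where
  pt := action d.Quotient
  ι :=
    { app i := actionMap (Con.map (c i) d fun x y h ↦ (hd x y).2 ⟨i, h⟩)
      naturality i j h := by
        ext X ⟨⟨x⟩, y⟩
        rfl }

variable [IsDirectedOrder I]

/-- All stages induce the same homomorphism on `M`, so any one of them can define the map out of the
colimit. -/
lemma actionHomEquiv_comp_mk'_eq (s : Cocone (quotientDiagram c)) (i j : I) :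
    (actionHomEquiv (s.ι.app i)).comp (c i).mk' = (actionHomEquiv (s.ι.app j)).comp (c j).mk' := by
  have key {i j : I} (h : i ≤ j) : (actionHomEquiv (s.ι.app i)).comp (c i).mk' =
      (actionHomEquiv (s.ι.app j)).comp (c j).mk' := by
    rw [← s.w (homOfLE h)]
    rfl
  obtain ⟨k, hi, hj⟩ := exists_ge_ge i j
  exact (key hi).trans (key hj).symm

variable [Nonempty I]

/-- Forming action monads commutes with directed unions of congruences. -/
noncomputable def isColimitQuotientCocone (hd : ∀ x y, d x y ↔ ∃ i, c i x y) :
    IsColimit (quotientCocone hd) where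
  desc s :=
    let i : I := Classical.arbitrary I
    actionHomEquiv.symm (d.lift ((actionHomEquiv (s.ι.app i)).comp (c i).mk') fun x y hxy ↦ by
      obtain ⟨j, hj⟩ := (hd x y).1 hxy
      rw [actionHomEquiv_comp_mk'_eq s i j]
      exact congrArg (actionHomEquiv (s.ι.app j)) ((c j).eq.2 hj))
  fac s i := by
    apply actionHomEquiv.injective
    refine (actionHomEquiv_actionMap_comp _ _).trans ?_
    rw [Equiv.apply_symm_apply]
    exact Con.hom_ext (actionHomEquiv_comp_mk'_eq s _ i)
  uniq s m hm := by
    apply actionHomEquiv.injective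
    rw [Equiv.apply_symm_apply]
    refine Con.hom_ext ?_
    exact congrArg (fun f ↦ (actionHomEquiv f).comp (c _).mk') (hm _)

/-- A quotient of a finitely generated free monoid by the union of a strictly increasing family of
congruences has an action monad that is not finitely presentable. -/
theorem not_isFinitelyPresentable_action {α : Type u} [Finite α] {c : I →o Con (FreeMonoid α)}
    {d : Con (FreeMonoid α)} (hd : ∀ x y, d x y ↔ ∃ i, c i x y) (hc : ∀ i, ¬ d ≤ c i) :
    ¬ IsFinitelyPresentable.{u} (action d.Quotient) := by
  intro hfp
  obtain ⟨j, p, hp⟩ := IsFinitelyPresentable.exists_hom_of_isColimit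
    (isColimitQuotientCocone hd) (𝟙 (action d.Quotient))
  let q : d.Quotient →* (c j).Quotient :=
    unaryEquiv.toMonoidHom.comp (actionHomEquiv p)
  have hq (m : d.Quotient) : Con.map (c j) d (fun x y h ↦ (hd x y).2 ⟨j, h⟩) (q m) = m :=
    congrArg unaryEquiv (DFunLike.congr_fun (congrArg actionHomEquiv hp) m)
  -- `q` is a section of `M/c j → M/d`. Words representing its values on generators are `d`-related
  -- to those generators, and these finitely many relations all hold at some `k ≥ j`. Hence `M → M/c
  -- k` factors through `M/d`.
  choose w hw using fun a : α ↦ (c j).mk'_surjective (q (d.mk' (FreeMonoid.of a)))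
  have hdw (a : α) : d (w a) (FreeMonoid.of a) := by
    have := hq (d.mk' (FreeMonoid.of a))
    rw [← hw] at this
    exact d.eq.1 this
  choose i hi using fun a ↦ (hd _ _).1 (hdw a)
  obtain ⟨k₀, hk₀⟩ := Finite.exists_le i
  obtain ⟨k, hk, hjk⟩ := exists_ge_ge k₀ j
  have e : ((Con.map (c j) (c k) (c.monotone hjk)).comp q).comp d.mk' = (c k).mk' := by
    refine FreeMonoid.hom_eq fun a ↦ ?_
    change Con.map (c j) (c k) (c.monotone hjk) (q (d.mk' (FreeMonoid.of a))) = _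
    rw [← hw]
    exact (c k).eq.2 (c.monotone ((hk₀ a).trans hk) (hi a))
  refine hc k fun x y hxy ↦ (c k).eq.1 ?_
  change (c k).mk' x = (c k).mk' y
  rw [← e]
  exact congrArg ((Con.map (c j) (c k) (c.monotone hjk)).comp q) (d.eq.2 hxy)

end Chain

end FinitaryMonad

/-! ### A strictly growing chain of Rees congruences. -/

section Rees

/-- The Rees congruence of a two-sided ideal of a monoid, which identifies its elements. -/
def reesCon {M : Type*} [Monoid M] (I : Set M) (hI : ∀ x ∈ I, ∀ a b, a * x * b ∈ I) : Con M where
  r x y := x = y ∨ x ∈ I ∧ y ∈ I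
  iseqv :=
    { refl x := Or.inl rfl
      symm := by
        rintro x y (rfl | h)
        exacts [Or.inl rfl, Or.inr h.symm]
      trans := by
        rintro x y z (rfl | h) (rfl | h')
        exacts [Or.inl rfl, Or.inr h', Or.inr h, Or.inr ⟨h.1, h'.2⟩] }
  mul' := by
    have left {x} (hx : x ∈ I) (a : M) : a * x ∈ I := by simpa using hI x hx a 1
    have right {x} (hx : x ∈ I) (b : M) : x * b ∈ I := by simpa using hI x hx 1 b
    rintro x y z w (rfl | h) (rfl | h')
    exacts [Or.inl rfl, Or.inr ⟨left h'.1 _, left h'.2 _⟩, Or.inr ⟨right h.1 _, right h.2 _⟩,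
      Or.inr ⟨right h.1 _, right h.2 _⟩]

/-- The word `b aᵏ b` in two letters. -/
def sandwichWord (k : ℕ) : FreeMonoid (ULift.{u} Bool) :=
  FreeMonoid.ofList (⟨true⟩ :: (List.replicate k ⟨false⟩ ++ [⟨true⟩]))

/-- A factor `b aᵏ b` must use both letters `b` of `b aᵐ b`, so it starts at the beginning and the
runs of `a` agree. -/
lemma eq_of_sandwichWord_eq_mul {m k : ℕ} {x y : FreeMonoid (ULift.{u} Bool)}
    (h : sandwichWord m = x * sandwichWord k * y) : k = m := by
  have h : (⟨true⟩ :: (List.replicate m ⟨false⟩ ++ [⟨true⟩]) : List (ULift.{u} Bool)) =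
    x.toList ++ (⟨true⟩ :: (List.replicate k ⟨false⟩ ++ [⟨true⟩])) ++ y.toList := h
  generalize x.toList = x, y.toList = y at h
  have key (m k : ℕ) (y : List (ULift.{u} Bool))
      (h : List.replicate m ⟨false⟩ ++ [⟨true⟩] = List.replicate k ⟨false⟩ ++ ⟨true⟩ :: y) :
      k = m := by
    induction m generalizing k with
    | zero => cases k <;> simp_all [List.replicate_succ]
    | succ m ih =>
      cases k with
      | zero => simp [List.replicate_succ] at h
      | succ k => simpa using ih k (by simpa [List.replicate_succ] using h)
  cases x with
  | nil => exact key m k y (by simpa using h)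
  | cons t x =>
    -- If `x` is nonempty it consumes the first `b`, leaving one `b` on the left against at least
    -- two on the right.
    have := congrArg (List.countP ULift.down) (List.cons.inj h).2
    simp [List.countP_append, List.countP_replicate] at this
    omega

/-- The ideal of words with a factor `b aᵏ b` where `k` belongs to a given set. -/
def sandwichIdeal (s : Set ℕ) : Set (FreeMonoid (ULift.{u} Bool)) :=
  {w | ∃ k ∈ s, ∃ x y, w = x * sandwichWord k * y}

lemma sandwichWord_mem_iff {s : Set ℕ} {m : ℕ} :
    sandwichWord.{u} m ∈ sandwichIdeal s ↔ m ∈ s :=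
  ⟨fun ⟨_, hk, _, _, h⟩ ↦ eq_of_sandwichWord_eq_mul h ▸ hk, fun h ↦ ⟨m, h, 1, 1, by simp⟩⟩

/-- The Rees congruence of `sandwichIdeal s`. -/
def sandwichCon (s : Set ℕ) : Con (FreeMonoid (ULift.{u} Bool)) :=
  reesCon (sandwichIdeal s) fun _ ⟨k, hk, x, y, h⟩ a b ↦ ⟨k, hk, a * x, y * b, by
    simp [h, mul_assoc]⟩

/-- The increasing chain of congruences identifying all words with a factor `b aᵏ b`, `k ≤ n`. -/
def sandwichChain : ULift.{u} ℕ →o Con (FreeMonoid (ULift.{u} Bool)) where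
  toFun n := sandwichCon (Set.Iic n.down)
  monotone' m n hmn x y := by
    have h : sandwichIdeal.{u} (Set.Iic m.down) ⊆ sandwichIdeal (Set.Iic n.down) :=
      fun _ ⟨k, hk, hw⟩ ↦ ⟨k, le_trans hk hmn, hw⟩
    rintro (rfl | hxy)
    exacts [Or.inl rfl, Or.inr ⟨h hxy.1, h hxy.2⟩]

lemma sandwichCon_univ_iff (x y : FreeMonoid (ULift.{u} Bool)) :
    sandwichCon Set.univ x y ↔ ∃ n, sandwichChain n x y := by
  constructor
  · rintro (rfl | ⟨⟨k, -, hx⟩, ⟨l, -, hy⟩⟩)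
    · exact ⟨⟨0⟩, Or.inl rfl⟩
    · exact ⟨⟨max k l⟩, Or.inr ⟨⟨k, le_max_left k l, hx⟩, ⟨l, le_max_right k l, hy⟩⟩⟩
  · rintro ⟨n, rfl | ⟨⟨k, -, hx⟩, ⟨l, -, hy⟩⟩⟩
    exacts [Or.inl rfl, Or.inr ⟨⟨k, trivial, hx⟩, ⟨l, trivial, hy⟩⟩]

lemma not_sandwichCon_univ_le (n : ULift.{u} ℕ) :
    ¬ sandwichCon Set.univ ≤ sandwichChain n := by
  intro h
  have hmem (k : ℕ) : sandwichWord.{u} k ∈ sandwichIdeal Set.univ :=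
    sandwichWord_mem_iff.2 trivial
  -- The words `b aⁿ⁺¹ b` and `b b` are distinct and identified in the union, but the first is
  -- outside the ideal of stage `n`.
  rcases h (Or.inr ⟨hmem (n.down + 1), hmem 0⟩) with h | h
  · exact absurd (eq_of_sandwichWord_eq_mul (x := 1) (y := 1) (by simpa using h)) (by simp)
  · exact absurd (sandwichWord_mem_iff.1 h.1) (by simp)

end Rees

theorem mainTheorem6 :
    ∃ T : FinitaryMonad.{u},
      IsFinitelyGeneratedObject.{u} T ∧ ¬ IsFinitelyPresentable.{u} T :=
  ⟨FinitaryMonad.action (sandwichCon Set.univ).Quotient,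
    FinitaryMonad.isFinitelyGeneratedObject_action _,
    FinitaryMonad.not_isFinitelyPresentable_action sandwichCon_univ_iff not_sandwichCon_univ_le⟩
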